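/- Let $\mathbb{D}$ be the open unit disc in $\mathbb{C}$ and let $\sigma$ be area measure on $\mathbb{D}$, normalized so that $\sigma(\mathbb{D})=1$. For $1<p<\infty$ let $A^p$ be the Bergman space of all analytic functions $g$ on $\mathbb{D}$ with $\int_{\mathbb{D}}|g|^p\,d\sigma<\infty$, and for $f\in L^1(\mathbb{D},\sigma)$ let $$(\mathcal{P}f)(z)=\int_{\mathbb{D}}\frac{f(\zeta)}{(1-\overline{\zeta}z)^2}\,d\sigma(\zeta),\qquad z\in\mathbb{D},$$ be its Bergman projection. Let $a\in\mathbb{D}$ with $a\neq 0$ and let $N\ge 0$ be an integer. Then there are functions $C_k:\mathbb{C}^{N+1}\to\mathbb{C}$, $k\ge 0$, depending only on $a$ and $N$, such that the following holds for every $1<p<\infty$, every $g\in A^p$ and every integer $n\ge 0$. If $g$ has a zero of order exactly $n$ at $a$ (where $n=0$ means $g(a)\neq 0$), then the function $\zeta\mapsto \overline{g(\zeta)}/(1-\overline{a}\zeta)^{N+2}$ belongs to $L^1(\mathbb{D},\sigma)$ and, for all $z\in\mathbb{D}$, $$\mathcal{P}\left(\frac{\overline{g(\zeta)}}{(1-\overline{a}\zeta)^{N+2}}\right)(z)=\sum_{k=0}^{N-n}\frac{C_k\bigl(g(a),g'(a),\dots,g^{(N)}(a)\bigr)}{(1-\overline{a}z)^{k+2}},$$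 where the sum is $0$ if $n>N$. -/

import Mathlib

open MeasureTheory
open scoped ENNReal ComplexConjugate

noncomputable section

/-- Area measure on the open unit disc, normalized so that the disc has measure `1`
(and regarded as a measure on `ℂ` carried by the disc). -/
def diskMeasure : Measure ℂ :=
  (ENNReal.ofReal Real.pi)⁻¹ • volume.restrict (Metric.ball (0 : ℂ) 1)

/-- Membership in the Bergman space `A^p`: `f` is analytic in the open unit disc and
its restriction to the disc belongs to `L^p` of normalized area measure. -/
def MemBergman (p : ℝ≥0∞) (f : ℂ → ℂ) : Prop :=
  AnalyticOnNhd ℂ f (Metric.ball 0 1) ∧ MemLp f p diskMeasure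

/-- The Bergman projection `(P f)(z) = ∫_D f(ζ) / (1 - conj ζ * z)^2 dσ(ζ)` of a function
`f` that is integrable on the unit disc, at a point `z` of the disc. -/
def bergmanProjection (f : ℂ → ℂ) (z : ℂ) : ℂ :=
  ∫ ζ, f ζ / (1 - conj ζ * z) ^ 2 ∂diskMeasure

end

open Metric Set
open scoped Real Nat

/-! The projection at `z` is the conjugate of `∫ G(ζ) / (1 - a * conj ζ) ^ (N + 2) dσ` with `G w = g
w / (1 - conj z * w) ^ 2`. On `|ζ| = r` one has `conj ζ = r ^ 2 / ζ`, so by Cauchy's formula the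
angular integral is a multiple of `H^(N+1) (a * r ^ 2)`, where `H w = w ^ (N + 1) * G w`. The radial
integral is then exact and leaves `H^(N) (a) / ((N + 1)! * a)`
(`integral_diskMeasure_div_one_sub_mul_conj_pow`). By Leibniz, the `i`-th derivative of the kernel
at `a` is paired with derivatives of `g` of order at most `N - i`. Partial fractions turn the former
into powers `k + 2` with `k ≤ i`; a zero of order `n` kills every `i > N - n`. -/

/-! ### Cauchy's formula on circles -/

/-- Cauchy's integral formula for derivatives, at an arbitrary point of the disc. -/
theorem factorial_mul_circleIntegral_div_sub_pow {r : ℝ} {c w : ℂ} (hw : w ∈ ball c r) (k : ℕ)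
    {f : ℂ → ℂ} (hf : AnalyticOnNhd ℂ f (closedBall c r)) :
    (k ! : ℂ) * (∮ z in C(c, r), f z / (z - w) ^ (k + 1)) =
      2 * π * Complex.I * iteratedDeriv k f w := by
  have hr : 0 < r := dist_nonneg.trans_lt hw
  have hne : ∀ z ∈ sphere c r, z - w ≠ 0 := by
    rintro z hz h
    rw [sub_eq_zero] at h
    subst h
    exact (mem_ball.1 hw).ne (mem_sphere.1 hz)
  induction k generalizing f with
  | zero =>
    have := (hf.differentiableOn).circleIntegral_sub_inv_smul hw
    simpa [div_eq_inv_mul] using this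
  | succ k ih =>
    have hf' := hf.deriv
    rw [iteratedDeriv_succ', ← ih hf']
    have hcont : ∀ {h : ℂ → ℂ} (m : ℕ), AnalyticOnNhd ℂ h (closedBall c r) →
        CircleIntegrable (fun z => h z / (z - w) ^ m) c r := fun m hh =>
      ContinuousOn.circleIntegrable hr.le
        ((hh.continuousOn.mono sphere_subset_closedBall).div (by fun_prop)
          fun z hz => pow_ne_zero _ (hne z hz))
    -- Integration by parts: the integrand is the derivative of `f z / (z - w) ^ (k + 1)`.
    have hz : (∮ z in C(c, r), (deriv f z / (z - w) ^ (k + 1) -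
        (k + 1 : ℂ) * (f z / (z - w) ^ (k + 2)))) = 0 := by
      refine circleIntegral.integral_eq_zero_of_hasDerivWithinAt
        (f := fun z => f z / (z - w) ^ (k + 1)) hr.le fun z hz => ?_
      have h1 := (hf z (sphere_subset_closedBall hz)).differentiableAt.hasDerivAt
      have h2 : HasDerivAt (fun z => (z - w) ^ (k + 1)) ((k + 1 : ℂ) * (z - w) ^ k) z := by
        simpa using ((hasDerivAt_id z).sub_const w).fun_pow (k + 1)
      have hn := hne z hz
      convert (h1.fun_div h2 (pow_ne_zero _ hn)).hasDerivWithinAt using 1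
      field_simp
      ring
    have hci : CircleIntegrable (fun z => (k + 1 : ℂ) * (f z / (z - w) ^ (k + 2))) c r :=
      IntervalIntegrable.const_mul (hcont _ hf) _
    rw [circleIntegral.integral_sub (hcont _ hf') hci,
      circleIntegral.integral_const_mul, sub_eq_zero] at hz
    rw [hz, Nat.factorial_succ]
    push_cast
    ring

/-! ### Area integrals in polar coordinates -/

/-- Provides the hypothesis of Fubini in `integral_diskMeasure_eq_polar`. -/
theorem integrableOn_polarCoord_target {E : ℂ → ℂ} (hE : Integrable E) :
    IntegrableOn (fun p : ℝ × ℝ => p.1 • E (Complex.polarCoord.symm p)) polarCoord.target := by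
  have h1 : Integrable (fun p : ℝ × ℝ => E (Complex.measurableEquivRealProd.symm p)) :=
    (Complex.volume_preserving_equiv_real_prod.symm).integrable_comp_of_integrable hE
  have h2 := (integrableOn_image_iff_integrableOn_abs_det_fderiv_smul volume
    (s := polarCoord.target) polarCoord.open_target.measurableSet
    (fun p _ => (hasFDerivAt_polarCoord_symm p).hasFDerivWithinAt)
    polarCoord.symm.injOn
    (fun p : ℝ × ℝ => E (Complex.measurableEquivRealProd.symm p))).1 h1.integrableOn
  refine h2.congr_fun (fun p hp => ?_) polarCoord.open_target.measurableSet
  simp only [det_fderivPolarCoordSymm]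
  rw [abs_of_pos hp.1]
  rfl

theorem polarCoord_symm_eq_circleMap (r θ : ℝ) :
    Complex.polarCoord.symm (r, θ) = circleMap 0 r θ := by
  simp [circleMap, Complex.exp_mul_I]

theorem integrable_diskMeasure_iff {F : ℂ → ℂ} :
    Integrable F diskMeasure ↔ IntegrableOn F (ball 0 1) := by
  unfold diskMeasure
  rw [integrable_smul_measure (by simp) (by simp [Real.pi_pos])]
  rfl

theorem integral_diskMeasure (F : ℂ → ℂ) :
    ∫ ζ, F ζ ∂diskMeasure = (π : ℂ)⁻¹ * ∫ ζ in ball 0 1, F ζ := by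
  unfold diskMeasure
  rw [integral_smul_measure]
  simp [Real.pi_pos.le]

/-- Integration over the disc in polar coordinates. -/
theorem integral_diskMeasure_eq_polar {F : ℂ → ℂ} (hF : Integrable F diskMeasure) :
    ∫ ζ, F ζ ∂diskMeasure =
      (π : ℂ)⁻¹ * ∫ r in (0 : ℝ)..1, (r : ℂ) * ∫ θ in (0 : ℝ)..(2 * π), F (circleMap 0 r θ) := by
  rw [integral_diskMeasure]
  congr 1
  have hE : Integrable ((ball (0 : ℂ) 1).indicator F) :=
    (integrable_indicator_iff measurableSet_ball).2 (integrable_diskMeasure_iff.1 hF)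
  have hI := integrableOn_polarCoord_target hE
  rw [← integral_indicator measurableSet_ball, ← Complex.integral_comp_polarCoord_symm]
  rw [polarCoord_target] at hI ⊢
  rw [Measure.volume_eq_prod, setIntegral_prod _ (by rwa [← Measure.volume_eq_prod]),
    intervalIntegral.integral_of_le zero_le_one, integral_Ioc_eq_integral_Ioo]
  rw [setIntegral_eq_of_subset_of_forall_sdiff_eq_zero measurableSet_Ioi
    (Ioo_subset_Ioi_self : Ioo (0 : ℝ) 1 ⊆ Ioi 0)]
  · refine setIntegral_congr_fun measurableSet_Ioo fun r hr => ?_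
    -- Polar coordinates use angles in `(-π, π)`; periodicity moves them to `(0, 2π)`.
    have hper : Function.Periodic (fun θ => F (circleMap 0 r θ)) (2 * π) := fun θ => by
      simp only [periodic_circleMap 0 r θ]
    have h1 := hper.intervalIntegral_add_eq 0 (-π)
    rw [zero_add, show -π + 2 * π = π by ring] at h1
    simp only
    rw [h1, intervalIntegral.integral_of_le (by linarith [Real.pi_pos]),
      integral_Ioc_eq_integral_Ioo, ← integral_const_mul]
    refine setIntegral_congr_fun measurableSet_Ioo fun θ _ => ?_
    simp only [polarCoord_symm_eq_circleMap, Complex.real_smul]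
    rw [indicator_of_mem]
    simp [abs_of_pos hr.1, hr.2]
  · intro r hr
    have h1 : 1 ≤ r := by
      by_contra! h
      exact hr.2 ⟨hr.1, h⟩
    refine integral_eq_zero_of_ae (Filter.Eventually.of_forall fun θ => ?_)
    simp only [polarCoord_symm_eq_circleMap, Pi.zero_apply]
    rw [indicator_of_notMem, smul_zero]
    simp [abs_of_pos (zero_lt_one.trans_le h1), h1]

/-! ### Circle means and the area formula for derivatives -/

theorem one_sub_mul_ne_zero {a z : ℂ} (ha : ‖a‖ < 1) (hz : ‖z‖ ≤ 1) : 1 - a * z ≠ 0 := by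
  intro h
  have h1 : ‖a * z‖ = 1 := by rw [← sub_eq_zero.1 h, norm_one]
  rw [norm_mul] at h1
  nlinarith [norm_nonneg a, norm_nonneg z]

theorem circleMap_zero_mul_conj (r θ : ℝ) :
    circleMap 0 r θ * conj (circleMap 0 r θ) = (r : ℂ) ^ 2 := by
  rw [Complex.mul_conj, Complex.normSq_eq_norm_sq, norm_circleMap_zero]
  simp

theorem iteratedDeriv_pow_mul_zero {G : ℂ → ℂ} (hG : AnalyticAt ℂ G 0) {m n : ℕ} (h : m < n) :
    iteratedDeriv m (fun w => w ^ n * G w) 0 = 0 := by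
  have han : AnalyticAt ℂ (fun w => w ^ n * G w) 0 := by fun_prop
  refine (natCast_le_analyticOrderAt_iff_iteratedDeriv_eq_zero han).1 ?_ m h
  exact (natCast_le_analyticOrderAt han).2 ⟨G, hG, by simp⟩

/-- The mean of `G(ζ) / (1 - a * conj ζ) ^ (m + 1)` over a circle. -/
theorem intervalIntegral_circleMap_div_one_sub_pow {a : ℂ} (ha : ‖a‖ < 1) (m : ℕ) {G : ℂ → ℂ}
    (hG : AnalyticOnNhd ℂ G (ball 0 1)) {r : ℝ} (hr0 : 0 < r) (hr1 : r < 1) :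
    ∫ θ in (0 : ℝ)..(2 * π), G (circleMap 0 r θ) / (1 - a * conj (circleMap 0 r θ)) ^ (m + 1) =
      2 * π / (m ! : ℂ) * iteratedDeriv m (fun w => w ^ m * G w) (a * (r : ℂ) ^ 2) := by
  have hw : a * (r : ℂ) ^ 2 ∈ ball (0 : ℂ) r := by
    simp only [mem_ball_zero_iff, norm_mul, norm_pow, Complex.norm_real, Real.norm_eq_abs,
      abs_of_pos hr0]
    nlinarith [norm_nonneg a, mul_pos hr0 hr0]
  have hH : AnalyticOnNhd ℂ (fun w => w ^ m * G w) (closedBall 0 r) := fun z hz =>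
    ((analyticAt_id.pow m).mul (hG z (closedBall_subset_ball hr1 hz)))
  have hc := factorial_mul_circleIntegral_div_sub_pow hw m hH
  have hI : (∮ z in C(0, r), (z ^ m * G z) / (z - a * (r : ℂ) ^ 2) ^ (m + 1)) =
      Complex.I * ∫ θ in (0 : ℝ)..(2 * π),
        G (circleMap 0 r θ) / (1 - a * conj (circleMap 0 r θ)) ^ (m + 1) := by
    rw [circleIntegral, ← intervalIntegral.integral_const_mul]
    refine intervalIntegral.integral_congr fun θ _ => ?_
    simp only [deriv_circleMap, smul_eq_mul]
    rw [← circleMap_zero_mul_conj r θ]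
    have hz0 : circleMap 0 r θ ≠ 0 := circleMap_ne_center hr0.ne'
    have hne : 1 - a * conj (circleMap 0 r θ) ≠ 0 :=
      one_sub_mul_ne_zero ha (by simp [abs_of_pos hr0, hr1.le])
    generalize circleMap 0 r θ = z at *
    rw [show z - a * (z * conj z) = z * (1 - a * conj z) by ring, mul_pow]
    field_simp
    ring
  rw [hI] at hc
  have hm : (m ! : ℂ) ≠ 0 := by exact_mod_cast m.factorial_ne_zero
  rw [div_mul_eq_mul_div, eq_div_iff hm]
  apply mul_left_cancel₀ Complex.I_ne_zero
  linear_combination hc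

theorem integrable_div_one_sub_mul_conj_pow {a : ℂ} (ha : ‖a‖ < 1) (m : ℕ) {G : ℂ → ℂ}
    (hG : Integrable G diskMeasure) :
    Integrable (fun ζ => G ζ / (1 - a * conj ζ) ^ m) diskMeasure := by
  rw [integrable_diskMeasure_iff] at hG ⊢
  have hc : ContinuousOn (fun ζ : ℂ => ((1 - a * conj ζ) ^ m)⁻¹) (closedBall 0 1) := by
    refine ContinuousOn.inv₀ (by fun_prop) fun z hz => pow_ne_zero _ (one_sub_mul_ne_zero ha ?_)
    simpa using hz
  obtain ⟨K, hK⟩ := (isCompact_closedBall (0 : ℂ) 1).exists_bound_of_continuousOn hc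
  simp only [div_eq_mul_inv]
  refine Integrable.mul_bdd (c := K) hG
    ((hc.mono ball_subset_closedBall).aestronglyMeasurable measurableSet_ball) ?_
  exact (ae_restrict_iff' measurableSet_ball).2
    (Filter.Eventually.of_forall fun z hz => hK z (ball_subset_closedBall hz))

/-- The derivatives at `a` of an integrable analytic function as area integrals. -/
theorem integral_diskMeasure_div_one_sub_mul_conj_pow {a : ℂ} (ha : ‖a‖ < 1) (ha0 : a ≠ 0) (N : ℕ)
    {G : ℂ → ℂ} (hG : AnalyticOnNhd ℂ G (ball 0 1)) (hGi : Integrable G diskMeasure) :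
    ∫ ζ, G ζ / (1 - a * conj ζ) ^ (N + 2) ∂diskMeasure =
      iteratedDeriv N (fun w => w ^ (N + 1) * G w) a / ((N + 1)! * a) := by
  set H : ℂ → ℂ := fun w => w ^ (N + 1) * G w with hHdef
  have hH : AnalyticOnNhd ℂ H (ball 0 1) := fun z hz =>
    ((analyticAt_id.pow (N + 1)).mul (hG z hz))
  have hHN : ∀ k, AnalyticOnNhd ℂ (iteratedDeriv k H) (ball 0 1) := fun k => by
    rw [iteratedDeriv_eq_iterate]
    exact hH.iterated_deriv k
  have hmem : ∀ r ∈ Icc (0 : ℝ) 1, a * (r : ℂ) ^ 2 ∈ ball (0 : ℂ) 1 := fun r hr => by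
    simp only [mem_ball_zero_iff, norm_mul, norm_pow, Complex.norm_real, Real.norm_eq_abs,
      abs_of_nonneg hr.1]
    nlinarith [norm_nonneg a, hr.1, hr.2, pow_le_one₀ (n := 2) hr.1 hr.2]
  have hfact : ((N + 1)! : ℂ) ≠ 0 := by exact_mod_cast (N + 1).factorial_ne_zero
  have hpi : (π : ℂ) ≠ 0 := by exact_mod_cast Real.pi_ne_zero
  have hftc : ∫ r in (0 : ℝ)..1, iteratedDeriv (N + 1) H (a * (r : ℂ) ^ 2) * (a * (2 * r)) =
      iteratedDeriv N H a := by
    rw [intervalIntegral.integral_eq_sub_of_hasDerivAt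
      (f := fun r : ℝ => iteratedDeriv N H (a * (r : ℂ) ^ 2))]
    -- The boundary term at `r = 0` vanishes because `H` has a zero of order at least `N + 1` at
    -- `0`.
    · have h0 := iteratedDeriv_pow_mul_zero (hG 0 (by simp)) (Nat.lt_succ_self N)
      simp [hHdef, h0]
    · intro r hr
      rw [uIcc_of_le zero_le_one] at hr
      have h1 := ((hHN N) _ (hmem r hr)).differentiableAt.hasDerivAt
      rw [← iteratedDeriv_succ] at h1
      have h2 : HasDerivAt (fun r : ℝ => a * (r : ℂ) ^ 2) (a * (2 * r)) r := by
        simpa using (((hasDerivAt_id r).ofReal_comp).fun_pow 2).const_mul a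
      exact h1.comp r h2
    · refine ContinuousOn.intervalIntegrable ?_
      rw [uIcc_of_le zero_le_one]
      refine ContinuousOn.mul ?_ (by fun_prop)
      exact (hHN (N + 1)).continuousOn.comp (by fun_prop) hmem
  rw [integral_diskMeasure_eq_polar (integrable_div_one_sub_mul_conj_pow ha _ hGi)]
  have hinner : ∫ r in (0 : ℝ)..1, (r : ℂ) * ∫ θ in (0 : ℝ)..(2 * π),
        G (circleMap 0 r θ) / (1 - a * conj (circleMap 0 r θ)) ^ (N + 2) =
      ∫ r in (0 : ℝ)..1, (π / ((N + 1)! * a) : ℂ) *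
        (iteratedDeriv (N + 1) H (a * (r : ℂ) ^ 2) * (a * (2 * r))) := by
    rw [intervalIntegral.integral_of_le zero_le_one, intervalIntegral.integral_of_le zero_le_one,
      integral_Ioc_eq_integral_Ioo, integral_Ioc_eq_integral_Ioo]
    refine setIntegral_congr_fun measurableSet_Ioo fun r hr => ?_
    rw [intervalIntegral_circleMap_div_one_sub_pow ha (N + 1) hG hr.1 hr.2, ← hHdef]
    field_simp
  rw [hinner, intervalIntegral.integral_const_mul, hftc]
  field_simp

/-! ### Leibniz rule, partial fractions and the coefficients -/

theorem iteratedDeriv_inv_one_sub_mul_sq {a b : ℂ} (h : 1 - b * a ≠ 0) (j : ℕ) :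
    iteratedDeriv j (fun w => ((1 - b * w) ^ 2)⁻¹) a = (j + 1)! * b ^ j / (1 - b * a) ^ (j + 2) := by
  induction j generalizing a with
  | zero => simp
  | succ j ih =>
    have hev : iteratedDeriv j (fun w => ((1 - b * w) ^ 2)⁻¹) =ᶠ[nhds a]
        fun w => (j + 1)! * b ^ j / (1 - b * w) ^ (j + 2) := by
      have : ∀ᶠ w in nhds a, 1 - b * w ≠ 0 :=
        ContinuousAt.eventually_ne (g := fun w => 1 - b * w) (by fun_prop) h
      filter_upwards [this] with w hw using ih hw
    rw [iteratedDeriv_succ, hev.deriv_eq]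
    have h1 : HasDerivAt (fun w : ℂ => 1 - b * w) (-b) a := by
      simpa using ((hasDerivAt_id a).const_mul b).const_sub 1
    have h2 := (hasDerivAt_const a ((j + 1)! * b ^ j : ℂ)).fun_div
      (h1.fun_pow (j + 2)) (pow_ne_zero _ h)
    rw [h2.deriv, Nat.factorial_succ (j + 1)]
    push_cast
    field_simp
    simp
    ring

/-- Partial fractions of `b ^ i / (1 - b * a) ^ (i + 2)` in powers of `1 / (1 - b * a)`. -/
theorem pow_div_one_sub_mul_pow {a b : ℂ} (ha0 : a ≠ 0) (h : 1 - b * a ≠ 0) {i N : ℕ}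
    (hi : i ≤ N) :
    b ^ i / (1 - b * a) ^ (i + 2) =
      ∑ k ∈ Finset.range (N + 1),
        (a ^ i)⁻¹ * ((i.choose k : ℂ) * (-1) ^ (i - k)) / (1 - b * a) ^ (k + 2) := by
  rw [← Finset.sum_subset (Finset.range_mono (Nat.succ_le_succ hi))]
  -- Binomial expansion of `b * a = 1 - (1 - b * a)`; this is where `a ≠ 0` enters.
  · have hb : b ^ i = (a ^ i)⁻¹ * (1 + -(1 - b * a)) ^ i := by
      rw [show 1 + -(1 - b * a) = b * a by ring, mul_pow]
      field_simp
    rw [hb, add_pow, Finset.mul_sum, Finset.sum_div]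
    refine Finset.sum_congr rfl fun k hk => ?_
    have hk' : k ≤ i := Nat.lt_succ_iff.1 (Finset.mem_range.1 hk)
    obtain ⟨l, rfl⟩ := Nat.exists_eq_add_of_le hk'
    rw [Nat.add_sub_cancel_left, neg_pow (1 - b * a), one_pow]
    field_simp
    ring
  · intro k _ hk
    rw [Nat.choose_eq_zero_of_lt (by simpa using hk)]
    simp

/-- The `j`-th derivative at `a` of `w ^ (N + 1) * g w`, in terms of the derivatives `v` of `g`. -/
noncomputable def powMulDeriv (a : ℂ) (N : ℕ) (v : Fin (N + 1) → ℂ) (j : ℕ) : ℂ :=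
  ∑ l ∈ Finset.range (j + 1), (j.choose l : ℂ) * (((N + 1).descFactorial l : ℂ) * a ^ (N + 1 - l)) *
    -- The default `0` is never reached when `j ≤ N`.
    if h : j - l < N + 1 then v ⟨j - l, h⟩ else 0

theorem iteratedDeriv_pow_mul_eq_powMulDeriv {a : ℂ} {g : ℂ → ℂ} (hg : AnalyticAt ℂ g a)
    {N j : ℕ} (hj : j ≤ N) :
    iteratedDeriv j (fun w => w ^ (N + 1) * g w) a =
      powMulDeriv a N (fun m => iteratedDeriv (m : ℕ) g a) j := by
  have hp : ContDiffAt ℂ j (fun w : ℂ => w ^ (N + 1)) a := by fun_prop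
  rw [iteratedDeriv_fun_mul hp hg.contDiffAt, powMulDeriv]
  refine Finset.sum_congr rfl fun l _ => ?_
  rw [dif_pos (by omega), iteratedDeriv_pow]

/-- The coefficients of the Bergman projection of `conj g / (1 - conj a * ζ) ^ (N + 2)`, in terms
of the derivatives `v` of `g` at `a`. -/
noncomputable def bergmanCoeff (a : ℂ) (N : ℕ) (v : Fin (N + 1) → ℂ) (k : ℕ) : ℂ :=
  conj ((∑ i ∈ Finset.range (N + 1), (N.choose i : ℂ) * ((i + 1)! : ℂ) * powMulDeriv a N v (N - i) *
    ((a ^ i)⁻¹ * ((i.choose k : ℂ) * (-1) ^ (i - k)))) / ((N + 1)! * a))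

/-- A nonzero summand needs `k ≤ i` and `n ≤ N - i`, which is incompatible with `N + 1 - n ≤ k`. -/
theorem bergmanCoeff_eq_zero {a : ℂ} {N n k : ℕ} {g : ℂ → ℂ} (hg : AnalyticAt ℂ g a)
    (hn : analyticOrderAt g a = n) (hk : N + 1 - n ≤ k) :
    bergmanCoeff a N (fun m => iteratedDeriv (m : ℕ) g a) k = 0 := by
  rw [bergmanCoeff, Finset.sum_eq_zero, zero_div, map_zero]
  intro i hi
  rw [Finset.mem_range] at hi
  rcases lt_or_ge i k with hik | hik
  · simp [Nat.choose_eq_zero_of_lt hik]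
  · have hz := (natCast_le_analyticOrderAt_iff_iteratedDeriv_eq_zero hg).1 hn.ge
    have hp : powMulDeriv a N (fun m => iteratedDeriv (m : ℕ) g a) (N - i) = 0 := by
      refine Finset.sum_eq_zero fun l _ => ?_
      rw [dif_pos (by omega)]
      simp only
      rw [hz _ (by omega), mul_zero]
    rw [hp]
    ring

theorem iteratedDeriv_pow_mul_mul_inv_sq {a b : ℂ} (ha0 : a ≠ 0) (h : 1 - b * a ≠ 0) (N : ℕ)
    {g : ℂ → ℂ} (hg : AnalyticAt ℂ g a) :
    iteratedDeriv N (fun w => w ^ (N + 1) * (g w * ((1 - b * w) ^ 2)⁻¹)) a / ((N + 1)! * a) =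
      ∑ k ∈ Finset.range (N + 1),
        conj (bergmanCoeff a N (fun m => iteratedDeriv (m : ℕ) g a) k) /
          (1 - b * a) ^ (k + 2) := by
  have h1 : AnalyticAt ℂ (fun w => w ^ (N + 1) * g w) a := by fun_prop
  have h2 : AnalyticAt ℂ (fun w => ((1 - b * w) ^ 2)⁻¹) a :=
    AnalyticAt.inv (by fun_prop) (pow_ne_zero _ h)
  simp only [← mul_assoc]
  rw [iteratedDeriv_fun_mul h1.contDiffAt h2.contDiffAt, ← Finset.sum_range_reflect]
  simp only [bergmanCoeff, Complex.conj_conj, Finset.sum_div]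
  rw [Finset.sum_comm]
  refine Finset.sum_congr rfl fun i hi => ?_
  have hi' : i ≤ N := Nat.lt_succ_iff.1 (Finset.mem_range.1 hi)
  rw [show N + 1 - 1 - i = N - i by omega, show N - (N - i) = i by omega, Nat.choose_symm hi',
    iteratedDeriv_pow_mul_eq_powMulDeriv hg (Nat.sub_le N i), iteratedDeriv_inv_one_sub_mul_sq h,
    mul_div_assoc ((i + 1)! : ℂ), pow_div_one_sub_mul_pow ha0 h hi', Finset.mul_sum, Finset.mul_sum,
    Finset.sum_div]
  refine Finset.sum_congr rfl fun k _ => ?_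
  ring

/-! ### Conclusion -/

theorem integrable_diskMeasure_of_memBergman {p : ℝ≥0∞} (hp : 1 < p) {g : ℂ → ℂ}
    (hg : MemBergman p g) : Integrable g diskMeasure := by
  have : IsFiniteMeasure diskMeasure := by
    refine ⟨?_⟩
    simp only [diskMeasure, Measure.smul_apply, Measure.restrict_apply_univ, smul_eq_mul]
    exact ENNReal.mul_lt_top (by simp [Real.pi_pos]) measure_ball_lt_top
  exact hg.2.integrable hp.le

theorem mainTheorem11 (a : ℂ) (ha : a ∈ Metric.ball (0 : ℂ) 1) (ha0 : a ≠ 0) (N : ℕ) :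
    ∃ C : (Fin (N + 1) → ℂ) → ℕ → ℂ,
      ∀ (p : ℝ≥0∞), 1 < p → p < ⊤ →
      ∀ (g : ℂ → ℂ), MemBergman p g →
      ∀ (n : ℕ), analyticOrderAt g a = (n : ℕ∞) →
        Integrable (fun ζ : ℂ => conj (g ζ) / (1 - conj a * ζ) ^ (N + 2)) diskMeasure ∧
        ∀ z ∈ Metric.ball (0 : ℂ) 1,
          bergmanProjection (fun ζ : ℂ => conj (g ζ) / (1 - conj a * ζ) ^ (N + 2)) z =
            ∑ k ∈ Finset.range (N + 1 - n),
              C (fun m => iteratedDeriv (m : ℕ) g a) k / (1 - conj a * z) ^ (k + 2) := by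
  have ha1 : ‖a‖ < 1 := by simpa using ha
  refine ⟨bergmanCoeff a N, fun p hp _ g hg n hn => ?_⟩
  have hgi := integrable_diskMeasure_of_memBergman hp hg
  refine ⟨?_, fun z hz => ?_⟩
  · have := (Complex.conjLIE.toContinuousLinearEquiv : ℂ →L[ℝ] ℂ).integrable_comp
      (integrable_div_one_sub_mul_conj_pow ha1 (N + 2) hgi)
    simpa using this
  have hz1 : ‖z‖ < 1 := by simpa using hz
  have hcz : ‖conj z‖ < 1 := by simpa using hz1
  have hGa : AnalyticOnNhd ℂ (fun w => g w * ((1 - conj z * w) ^ 2)⁻¹) (ball 0 1) := fun w hw =>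
    (hg.1 w hw).mul (AnalyticAt.inv (by fun_prop)
      (pow_ne_zero _ (one_sub_mul_ne_zero hcz (by simpa using (mem_ball_zero_iff.1 hw).le))))
  have hGi : Integrable (fun w => g w * ((1 - conj z * w) ^ 2)⁻¹) diskMeasure := by
    -- Conjugating before and after turns `1 - conj z * w` into the form `1 - z * conj w` of the
    -- integrability lemma.
    have := (Complex.conjLIE.toContinuousLinearEquiv : ℂ →L[ℝ] ℂ).integrable_comp
      (integrable_div_one_sub_mul_conj_pow hz1 2
        ((Complex.conjLIE.toContinuousLinearEquiv : ℂ →L[ℝ] ℂ).integrable_comp hgi))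
    simpa [div_eq_mul_inv] using this
  have hza : 1 - conj z * a ≠ 0 := one_sub_mul_ne_zero hcz ha1.le
  have key := integral_diskMeasure_div_one_sub_mul_conj_pow ha1 ha0 N hGa hGi
  rw [iteratedDeriv_pow_mul_mul_inv_sq ha0 hza N (hg.1 a ha)] at key
  have hproj : bergmanProjection (fun ζ : ℂ => conj (g ζ) / (1 - conj a * ζ) ^ (N + 2)) z =
      conj (∫ ζ, g ζ * ((1 - conj z * ζ) ^ 2)⁻¹ / (1 - a * conj ζ) ^ (N + 2) ∂diskMeasure) := by
    rw [bergmanProjection, ← integral_conj]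
    refine integral_congr_ae (Filter.Eventually.of_forall fun ζ => ?_)
    simp only [map_div₀, map_mul, map_inv₀, map_pow, map_sub, map_one, Complex.conj_conj]
    rw [mul_comm z]
    ring
  rw [hproj, key, map_sum, Finset.sum_subset (Finset.range_mono (Nat.sub_le (N + 1) n))]
  · refine Finset.sum_congr rfl fun k _ => ?_
    simp [mul_comm]
  · intro k _ hk
    rw [bergmanCoeff_eq_zero (hg.1 a ha) hn (by simpa using hk), zero_div]
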